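/- Let $\Delta$ be the simplex category (objects $[n]=\{0<1<\cdots<n\}$, monotone maps). A map $f\colon[k]\to[n]$ of $\Delta$ is \emph{active} if $f(0)=0$ and $f(k)=n$, and \emph{inert} if $f(i+1)=f(i)+1$ for all $0\le i<k$. Let $j\colon\Delta_{\mathrm{inert}}\to\Delta$ be the inclusion of the subcategory with all objects and only the inert maps. Let $\mathcal S$ be the $\infty$-category of spaces ($\infty$-groupoids), let $\mathrm{PrSh}(\mathcal C)$ denote the $\infty$-category of presheaves $\mathcal C^{\mathrm{op}}\to\mathcal S$, and let $j_!\colon \mathrm{PrSh}(\Delta_{\mathrm{inert}})\to\mathrm{PrSh}(\Delta)$ be left Kan extension along $j$, that is, the left adjoint of the restriction functor $j^*$. A map $Y\to X$ of simplicial spaces is \emph{CULF} if for every active map $[k]\to[n]$ the naturality square with horizontal maps $Y_n\to Y_k$ and $X_n\to X_k$ is a (homotopy) pullback. \textbf{Proposition.} The left adjoint $j_!$ exists, and for every map $A\to B$ in $\mathrm{PrSh}(\Delta_{\mathrm{inert}})$, the induced map $j_!(A)\to j_!(B)$ is CULF. -/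

import Mathlib

open CategoryTheory Simplicial

universe u

namespace FreeDecomposition

/-! ### Active and inert maps -/

/-- A map of `Δ` is active if it preserves end-points. -/
def IsActive {k n : SimplexCategory} (f : k ⟶ n) : Prop :=
  f.toOrderHom 0 = 0 ∧ f.toOrderHom (Fin.last k.len) = Fin.last n.len

/-- The inert (that is, distance preserving) maps of `Δ`: those with `f (i + 1) = f i + 1`. -/
def inert : MorphismProperty SimplexCategory := fun m _ f =>
  ∀ i : Fin m.len, (f.toOrderHom i.succ : ℕ) = (f.toOrderHom i.castSucc : ℕ) + 1

theorem inert_comp {k m n : SimplexCategory} (f : k ⟶ m) (g : m ⟶ n)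
    (hf : inert f) (hg : inert g) : inert (f ≫ g) := by
  intro i
  have h := hf i
  have hlt : (f.toOrderHom i.castSucc : ℕ) < m.len := by
    have := (f.toOrderHom i.succ).isLt
    omega
  have h1 : f.toOrderHom i.castSucc =
      (⟨(f.toOrderHom i.castSucc : ℕ), hlt⟩ : Fin m.len).castSucc := by
    ext; simp
  have h2 : f.toOrderHom i.succ =
      (⟨(f.toOrderHom i.castSucc : ℕ), hlt⟩ : Fin m.len).succ := by
    ext; simpa using h
  have hgi := hg ⟨(f.toOrderHom i.castSucc : ℕ), hlt⟩
  rw [← h1, ← h2] at hgi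
  simpa using hgi

instance : inert.IsMultiplicative where
  id_mem _ i := by simp
  comp_mem f g hf hg := inert_comp f g hf hg

/-- The category `Δ_inert`: same objects as `Δ`, and only the inert maps. -/
abbrev SimplexInert : Type := WideSubcategory inert

/-- The inclusion `j : Δ_inert ⥤ Δ`. -/
abbrev j : SimplexInert ⥤ SimplexCategory := wideSubcategoryInclusion inert

/-! ### Spaces -/

/-- Spaces (`∞`-groupoids): the category of Kan complexes. -/
abbrev Space : Type (u + 1) :=
  ObjectProperty.FullSubcategory (fun X : SSet.{u} => SSet.KanComplex X)

/-- The homotopy equivalences between Kan complexes. -/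
def homotopyEquivalences : MorphismProperty Space.{u} := fun X Y f =>
  ∃ g : Y ⟶ X, Nonempty (SSet.Homotopy (f ≫ g).hom (𝟙 X.obj)) ∧
    Nonempty (SSet.Homotopy (g ≫ f).hom (𝟙 Y.obj))

open SSet.modelCategoryQuillen in
/-- The square of spaces
```
  P ---fst---> X
  |            |
 snd           f
  v            v
  Y ----g----> Z
```
is a homotopy pullback (that is, it commutes and is a pullback in the `∞`-category of spaces):
`f` factors as a homotopy equivalence `i : X ⟶ E` followed by a Kan fibration `p : E ⟶ Z`, and
the induced map from `P` to the strict pullback `Q` of `p` and `g` is a homotopy equivalence.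
(As usual, this does not depend on the choice of the factorization, and such a factorization
always exists. The equations force the given square to commute.) -/
def IsHomotopyPullback {P X Y Z : Space.{u}} (fst : P ⟶ X) (snd : P ⟶ Y)
    (f : X ⟶ Z) (g : Y ⟶ Z) : Prop :=
  ∃ (E Q : Space.{u}) (i : X ⟶ E) (p : E ⟶ Z) (q₁ : Q ⟶ E) (q₂ : Q ⟶ Y) (w : P ⟶ Q),
    homotopyEquivalences i ∧ HomotopicalAlgebra.Fibration p.hom ∧ i ≫ p = f ∧
    IsPullback q₁.hom q₂.hom p.hom g.hom ∧
    homotopyEquivalences w ∧ w ≫ q₁ = fst ≫ i ∧ w ≫ q₂ = snd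

/-! ### Presheaves of spaces -/

section Presheaves

variable (C : Type) [Category.{0} C]

/-- Strict diagrams of Kan complexes of shape `Cᵒᵖ`. -/
abbrev Diagram : Type (u + 1) := Cᵒᵖ ⥤ Space.{u}

/-- The levelwise homotopy equivalences of diagrams. -/
abbrev levelwiseEquivalences : MorphismProperty (Diagram.{u} C) :=
  homotopyEquivalences.{u}.functorCategory Cᵒᵖ

/-- The homotopy category of the `∞`-category `PrSh(C)` of presheaves of spaces on `C`: its
objects are the presheaves of spaces and its morphisms are the homotopy classes of (homotopy
coherent) maps between them. It is presented as the localization of the category of strict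
diagrams of Kan complexes at the levelwise homotopy equivalences. -/
abbrev HoPrSh : Type (u + 1) := (levelwiseEquivalences.{u} C).Localization

/-- The localization functor, sending a strict diagram to the presheaf of spaces it presents. -/
abbrev toHo : Diagram.{u} C ⥤ HoPrSh.{u} C := (levelwiseEquivalences.{u} C).Q

end Presheaves

/-- Restriction of strict diagrams along `j`; it preserves levelwise homotopy equivalences. -/
def restrictDiagram : LocalizerMorphism (levelwiseEquivalences.{u} SimplexCategory)
    (levelwiseEquivalences.{u} SimplexInert) where
  functor := (Functor.whiskeringLeft _ _ _).obj j.op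
  map _ _ _ hf c := hf (j.op.obj c)

/-- The restriction functor `j^* : PrSh(Δ) ⥤ PrSh(Δ_inert)` on homotopy categories. The left Kan
extension functor `j_!` is its left adjoint. -/
noncomputable def jStar : HoPrSh.{u} SimplexCategory ⥤ HoPrSh.{u} SimplexInert :=
  restrictDiagram.{u}.localizedFunctor (toHo.{u} SimplexCategory) (toHo.{u} SimplexInert)

/-! ### CULF maps -/

/-- A strict map `F : Y ⟶ X` of simplicial spaces is CULF if it is cartesian on active maps:
its naturality squares on active maps are homotopy pullbacks. -/
def IsCulfStrict {Y X : Diagram.{u} SimplexCategory} (F : Y ⟶ X) : Prop :=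
  ∀ ⦃k n : SimplexCategory⦄ (α : k ⟶ n), IsActive α →
    IsHomotopyPullback (F.app (Opposite.op n)) (Y.map α.op) (X.map α.op) (F.app (Opposite.op k))

/-- A map of simplicial spaces (in the homotopy category of `PrSh(Δ)`) is CULF if it is presented,
up to equivalence, by a strict map which is CULF. (Every map is presented by a strict map, and
being CULF does not depend on the choice of this presentation.) -/
def IsCulf {Y X : HoPrSh.{u} SimplexCategory} (φ : Y ⟶ X) : Prop :=
  ∃ (Y' X' : Diagram.{u} SimplexCategory) (F : Y' ⟶ X'),
    Nonempty (Arrow.mk φ ≅ Arrow.mk ((toHo.{u} SimplexCategory).map F)) ∧ IsCulfStrict F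

end FreeDecomposition

/-!
Every map of `Δ` is, in a unique way, an active map followed by an inert map
(`exists_active_inert`, `active_inert_unique`). Hence, for a strict diagram `A` on `Δ_inert`, the
pointwise left Kan extension along `j` is already homotopically correct in its naive form: its
value at `n` is the coproduct of the spaces `A m` over all active maps `n ⟶ m`, and a map
`θ : n' ⟶ n` acts on the summand of `α : n ⟶ m` by factoring `θ ≫ α` as `α'` followed by `ι` and
applying `A ι`. Coproducts preserve Kan complexes and homotopy equivalences, so this functor
`jShriekStrict`, which is strictly left adjoint to restriction (`jShriekStrictAdj`), descends to
the homotopy categories together with the adjunction (`jShriekHoAdj`).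

If `θ` is active then so is `θ ≫ α`, and `θ` merely reindexes the summands (`jShriekMap_active`).
A reindexing of summands is a Kan fibration, because horns are connected
(`fibration_coprodMap`), and its naturality squares with respect to a map of diagrams are strict
pullbacks (`isPullback_coprodMap`). These are therefore homotopy pullbacks, and the left Kan
extension of a strict map is CULF (`isCulfStrict_jShriekStrict`).

It remains to see that every map of the homotopy category is, up to isomorphism, the image of a
strict map (`exists_strict_presentation`). It is in fact a fraction `t⁻¹ ≫ F`, where `t` is a
levelwise trivial fibration (`fractions_eq_top`). Such fractions compose because trivial
fibrations are stable under pullback. The inverse of a levelwise equivalence `w : A ⟶ B` is such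
a fraction because `w` factors through the mapping path space `N` of `w`: the projection
`N ⟶ A` is a trivial fibration with a section, and evaluation at the end of a path is a fibration
`N ⟶ B` which is a homotopy equivalence, hence a trivial fibration (`rlp_of_isHomotopyEquiv`).
Trivial Kan fibrations are encoded by the right lifting property `I.rlp` with respect to the
boundary inclusions. The extension problems which arise are solved by the fact that the
pushout-product of a monomorphism and an anodyne extension is anodyne.
-/

namespace FreeDecomposition

/-! ### Extending homotopies -/

section
open MonoidalCategory CartesianMonoidalCategory HomotopicalAlgebra SSet SSet.modelCategoryQuillen
  Limits MonoidalClosed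

variable {X Y Z E : SSet.{u}}

theorem whiskerLeft_δ_one : X ◁ (stdSimplex.δ 1 : Δ[0] ⟶ Δ[1]) = fst _ _ ≫ ι₀ := by
  rw [stdSimplex.δ_one_eq_const]; rfl

theorem whiskerLeft_δ_zero : X ◁ (stdSimplex.δ 0 : Δ[0] ⟶ Δ[1]) = fst _ _ ≫ ι₁ := by
  rw [stdSimplex.δ_zero_eq_const]; rfl

/-- Two edges of the total space of a fibration with the same source and the same image form an
outer horn; filling it over a degenerate triangle gives an edge between their targets which lies
over a point. -/
theorem exists_edge_of_fibration {p : X ⟶ Y} [Fibration p] (e₁ e₂ : Δ[1] ⟶ X)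
    (h : stdSimplex.δ 1 ≫ e₁ = stdSimplex.δ 1 ≫ e₂) (hp : e₁ ≫ p = e₂ ≫ p) :
    ∃ e : Δ[1] ⟶ X, stdSimplex.δ 1 ≫ e = stdSimplex.δ 0 ≫ e₁ ∧
      stdSimplex.δ 0 ≫ e = stdSimplex.δ 0 ≫ e₂ ∧
      e ≫ p = stdSimplex.σ 0 ≫ stdSimplex.δ 0 ≫ e₁ ≫ p := by
  have hc : horn.IsCompatible (i := (0 : Fin 3)) (fun j _ => if j = 1 then e₂ else e₁) := by
    intro j k hj hk hjk
    obtain rfl : j = 1 := by grind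
    obtain rfl : k = 2 := by grind
    simpa using! h.symm
  have h11 : (stdSimplex.δ 1 : Δ[1] ⟶ Δ[2]) ≫ stdSimplex.σ 1 = 𝟙 (Δ[1] : SSet.{u}) :=
    stdSimplex.δ_comp_σ_self (i := (1 : Fin 2))
  have h21 : (stdSimplex.δ 2 : Δ[1] ⟶ Δ[2]) ≫ stdSimplex.σ 1 = 𝟙 (Δ[1] : SSet.{u}) :=
    stdSimplex.δ_comp_σ_succ (i := (1 : Fin 2))
  have h01 : (stdSimplex.δ 0 : (Δ[1] : SSet.{u}) ⟶ Δ[2]) ≫ stdSimplex.σ 1 =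
      stdSimplex.σ 0 ≫ stdSimplex.δ 0 :=
    stdSimplex.δ_comp_σ_of_le (i := (0 : Fin 2)) (j := (0 : Fin 1)) le_rfl
  -- In the horn, `e₁` and `e₂` are the edges `0 → 1` and `0 → 2`, the faces opposite `2` and `1`.
  obtain ⟨φ, h₁, h₂⟩ := hc.exists_lift p (stdSimplex.σ 1 ≫ e₁ ≫ p) (by
    intro j hj
    obtain rfl | rfl : j = 1 ∨ j = 2 := by grind
    · rw [reassoc_of% h11, if_pos rfl, hp]
    · rw [reassoc_of% h21, if_neg (by decide)])
  have h1 : stdSimplex.δ 1 ≫ φ = e₂ := h₁ 1 (by decide)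
  have h2 : stdSimplex.δ 2 ≫ φ = e₁ := h₁ 2 (by decide)
  refine ⟨stdSimplex.δ 0 ≫ φ, ?_, ?_, ?_⟩
  · rw [← h2]
    exact (stdSimplex.δ_comp_δ_assoc (i := (0 : Fin 2)) (j := (1 : Fin 2)) (by decide) φ).symm
  · rw [← h1]
    exact (stdSimplex.δ_comp_δ_assoc (i := (0 : Fin 2)) (j := (0 : Fin 2)) le_rfl φ).symm
  · rw [Category.assoc, h₂, reassoc_of% h01]

/-- Two homotopies with the same source and the same image under a fibration give a homotopy
between their targets which is constant under the fibration. -/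
theorem exists_homotopy_of_fibration {p : E ⟶ Z} [Fibration p] (h₁ h₂ : X ⊗ Δ[1] ⟶ E)
    (h : ι₀ ≫ h₁ = ι₀ ≫ h₂) (hp : h₁ ≫ p = h₂ ≫ p) :
    ∃ k : X ⊗ Δ[1] ⟶ E, ι₀ ≫ k = ι₁ ≫ h₁ ∧ ι₁ ≫ k = ι₁ ≫ h₂ ∧
      k ≫ p = fst _ _ ≫ ι₁ ≫ h₁ ≫ p := by
  obtain ⟨e, he₁, he₂, he₃⟩ := exists_edge_of_fibration (p := (ihom X).map p) (curry h₁) (curry h₂)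
    (by rw [← curry_natural_left, ← curry_natural_left, whiskerLeft_δ_one, Category.assoc, h,
      Category.assoc])
    (by rw [← curry_natural_right, ← curry_natural_right, hp])
  have : Epi (fst X (Δ[0] : SSet.{u})) :=
    (SplitEpi.mk (lift (𝟙 X) (const (stdSimplex.obj₀Equiv.symm 0))) (lift_fst _ _)).epi
  obtain ⟨k, rfl⟩ : ∃ k, e = curry k := ⟨uncurry e, (curry_uncurry e).symm⟩
  rw [← curry_natural_left, ← curry_natural_left, whiskerLeft_δ_one, whiskerLeft_δ_zero] at he₁
  rw [← curry_natural_left, ← curry_natural_left, whiskerLeft_δ_zero] at he₂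
  rw [← curry_natural_right, ← curry_natural_right, ← curry_natural_left, ← curry_natural_left,
    whiskerLeft_δ_zero] at he₃
  have he₁ := curry_injective he₁
  have he₂ := curry_injective he₂
  have he₃ := curry_injective he₃
  refine ⟨k, ?_, ?_, ?_⟩
  · rwa [Category.assoc, Category.assoc, cancel_epi] at he₁
  · rwa [Category.assoc, Category.assoc, cancel_epi] at he₂
  · rw [he₃, Category.assoc, ← Category.assoc]
    rfl
theorem eq_const_of_mem_horn {n : SimplexCategoryᵒᵖ} {t : (Δ[1] : SSet.{u}).obj n}
    (ht : t ∈ (Λ[1, 0] : (Δ[1] : SSet.{u}).Subcomplex).obj n) : t = stdSimplex.const 1 0 n := by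
  obtain ⟨n⟩ := n
  induction n using SimplexCategory.rec with | _ n
  rw [mem_horn_iff_notMem_range] at ht
  obtain ⟨j, h, hj⟩ := ht
  ext i : 1
  change t i = 0
  have : t i ≠ j := fun h' => hj ⟨i, h'⟩
  lia

theorem eq_const_of_mem_boundary {n : SimplexCategoryᵒᵖ} {t : (Δ[1] : SSet.{u}).obj n}
    (ht : t ∈ (∂Δ[1] : (Δ[1] : SSet.{u}).Subcomplex).obj n) :
    t = stdSimplex.const 1 0 n ∨ t = stdSimplex.const 1 1 n := by
  obtain ⟨n⟩ := n
  induction n using SimplexCategory.rec with | _ n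
  rw [mem_boundary_iff_notMem_range] at ht
  obtain ⟨j, hj⟩ := ht
  have h (i) : t i ≠ j := fun h' => hj ⟨i, h'⟩
  obtain rfl | rfl : j = 0 ∨ j = 1 := by lia
  · right
    ext i : 1
    have := h i
    change t i = 1
    lia
  · left
    ext i : 1
    have := h i
    change t i = 0
    lia

theorem whiskerLeft_horn_ι : X ◁ (Λ[1, 0] : (Δ[1] : SSet.{u}).Subcomplex).ι = fst _ _ ≫ ι₀ := by
  apply CartesianMonoidalCategory.hom_ext
  · rfl
  · ext n ⟨x, t⟩
    exact eq_const_of_mem_horn t.2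

/-- The homotopy extension and lifting property: a lift along a fibration, given on a subcomplex
at all times and everywhere at time `0`, extends. -/
theorem exists_extension_of_start {S : X.Subcomplex} {p : E ⟶ Z} [Fibration p]
    (u : (S : SSet) ⊗ Δ[1] ⟶ E) (v : X ⟶ E) (b : X ⊗ Δ[1] ⟶ Z)
    (huv : ι₀ ≫ u = S.ι ≫ v) (hu : u ≫ p = S.ι ▷ _ ≫ b) (hv : v ≫ p = ι₀ ≫ b) :
    ∃ l : X ⊗ Δ[1] ⟶ E, S.ι ▷ _ ≫ l = u ∧ ι₀ ≫ l = v ∧ l ≫ p = b := by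
  let sq := Subcomplex.unionProd.isPushout S (Λ[1, 0] : (Δ[1] : SSet.{u}).Subcomplex)
  let k := sq.desc (fst _ _ ≫ v) u (by
    rw [whiskerLeft_horn_ι, Category.assoc, huv]; rfl)
  have hk₁ : Subcomplex.unionProd.ι₁ _ _ ≫ k = fst _ _ ≫ v := sq.inl_desc _ _ _
  have hk₂ : Subcomplex.unionProd.ι₂ _ _ ≫ k = u := sq.inr_desc _ _ _
  have hlift : HasLiftingProperty (S.unionProd (Λ[1, 0] : (Δ[1] : SSet.{u}).Subcomplex)).ι p :=
    anodyneExtensions_unionProd_ι S _ (.horn_ι 0) _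
      ((HomotopicalAlgebra.fibration_iff p).1 inferInstance)
  have comm : CommSq k (S.unionProd (Λ[1, 0] : (Δ[1] : SSet.{u}).Subcomplex)).ι p b := ⟨by
    apply sq.hom_ext
    · rw [reassoc_of% hk₁, hv, Subcomplex.unionProd.ι₁_ι_assoc, whiskerLeft_horn_ι, Category.assoc]
    · rw [reassoc_of% hk₂, hu, Subcomplex.unionProd.ι₂_ι_assoc]⟩
  refine ⟨comm.lift, ?_, ?_, comm.fac_right⟩
  · rw [← Subcomplex.unionProd.ι₂_ι_assoc, comm.fac_left, hk₂]
  · have h0 : stdSimplex.obj₀Equiv.symm 0 ∈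
        (Λ[1, 0] : (Δ[1] : SSet.{u}).Subcomplex).obj (Opposite.op ⦋0⦌) := by
      rw [mem_horn_iff_notMem_range]
      refine ⟨1, by decide, ?_⟩
      rintro ⟨i, hi⟩
      change (0 : Fin 2) = 1 at hi
      lia
    have h : (ι₀ : X ⟶ X ⊗ Δ[1]) = lift (𝟙 X) (const (Y := (Λ[1, 0] : SSet.{u})) ⟨_, h0⟩) ≫
      X ◁ (Λ[1, 0] : (Δ[1] : SSet.{u}).Subcomplex).ι := rfl
    rw [h, Category.assoc, ← Subcomplex.unionProd.ι₁_ι_assoc, comm.fac_left, hk₁, lift_fst_assoc,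
      Category.id_comp]

open Classical in
/-- The map out of `X ⊗ ∂Δ[1]`, two disjoint copies of `X`, given by two maps out of `X`. -/
noncomputable def boundaryDesc (v₀ v₁ : X ⟶ E) : X ⊗ (∂Δ[1] : SSet.{u}) ⟶ E where
  app n := ↾fun x =>
    if x.2.1 = stdSimplex.const 1 0 n then v₀.app n x.1 else v₁.app n x.1
  naturality n m f := by
    ext ⟨x, t, ht⟩
    have hne (k) : (stdSimplex.const 1 1 k : (Δ[1] : SSet.{u}).obj k) ≠ stdSimplex.const 1 0 k :=
      fun h => absurd (congr_arg (fun t => t.down.toOrderHom 0) h) (by simp)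
    obtain rfl | rfl := eq_const_of_mem_boundary ht
    · have h : (Δ[1] : SSet.{u}).map f (stdSimplex.const 1 0 n) = stdSimplex.const 1 0 m := rfl
      refine (if_pos h).trans (Eq.trans ?_ (congr_arg (E.map f) (if_pos rfl)).symm)
      exact ConcreteCategory.congr_hom (v₀.naturality f) x
    · have h : (Δ[1] : SSet.{u}).map f (stdSimplex.const 1 1 n) = stdSimplex.const 1 1 m := rfl
      refine (if_neg (h.trans_ne (hne m))).trans
        (Eq.trans ?_ (congr_arg (E.map f) (if_neg (hne n))).symm)
      exact ConcreteCategory.congr_hom (v₁.naturality f) x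

theorem const_mem_boundary (i : Fin 2) (n : SimplexCategoryᵒᵖ) :
    stdSimplex.const 1 i n ∈ (∂Δ[1] : (Δ[1] : SSet.{u}).Subcomplex).obj n := by
  obtain ⟨n⟩ := n
  induction n using SimplexCategory.rec with | _ n
  rw [mem_boundary_iff_notMem_range]
  refine ⟨1 - i, ?_⟩
  rintro ⟨k, hk⟩
  change i = 1 - i at hk
  lia

theorem boundaryDesc_app_zero (v₀ v₁ : X ⟶ E) {n : SimplexCategoryᵒᵖ} (x : X.obj n) :
    (boundaryDesc v₀ v₁).app n (x, ⟨_, const_mem_boundary 0 n⟩) = v₀.app n x :=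
  if_pos rfl

theorem boundaryDesc_app_one (v₀ v₁ : X ⟶ E) {n : SimplexCategoryᵒᵖ} (x : X.obj n) :
    (boundaryDesc v₀ v₁).app n (x, ⟨_, const_mem_boundary 1 n⟩) = v₁.app n x :=
  if_neg fun h => absurd (congr_arg (fun t => t.down.toOrderHom 0) h) (by simp)

theorem boundary_hom_ext {f g : X ⊗ (∂Δ[1] : SSet.{u}) ⟶ E}
    (h : ∀ (n : SimplexCategoryᵒᵖ) (x : X.obj n) (i : Fin 2),
      f.app n (x, ⟨_, const_mem_boundary i n⟩) = g.app n (x, ⟨_, const_mem_boundary i n⟩)) :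
    f = g := by
  ext n ⟨x, t, ht⟩
  obtain rfl | rfl := eq_const_of_mem_boundary ht
  · exact h n x 0
  · exact h n x 1

theorem whiskerLeft_boundary_ι_comp (k : X ⊗ Δ[1] ⟶ E) :
    X ◁ (∂Δ[1] : (Δ[1] : SSet.{u}).Subcomplex).ι ≫ k = boundaryDesc (ι₀ ≫ k) (ι₁ ≫ k) := by
  refine boundary_hom_ext fun n x i => ?_
  obtain rfl | rfl : i = 0 ∨ i = 1 := by lia
  · exact (boundaryDesc_app_zero (ι₀ ≫ k) (ι₁ ≫ k) x).symm
  · exact (boundaryDesc_app_one (ι₀ ≫ k) (ι₁ ≫ k) x).symm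

theorem boundaryDesc_comp (v₀ v₁ : X ⟶ E) (p : E ⟶ Z) :
    boundaryDesc v₀ v₁ ≫ p = boundaryDesc (v₀ ≫ p) (v₁ ≫ p) := by
  refine boundary_hom_ext fun n x i => ?_
  obtain rfl | rfl : i = 0 ∨ i = 1 := by lia
  · exact (congr_arg (p.app n) (boundaryDesc_app_zero v₀ v₁ x)).trans
      (boundaryDesc_app_zero (v₀ ≫ p) (v₁ ≫ p) x).symm
  · exact (congr_arg (p.app n) (boundaryDesc_app_one v₀ v₁ x)).trans
      (boundaryDesc_app_one (v₀ ≫ p) (v₁ ≫ p) x).symm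

theorem whiskerRight_comp_boundaryDesc (q : Y ⟶ X) (v₀ v₁ : X ⟶ E) :
    q ▷ _ ≫ boundaryDesc v₀ v₁ = boundaryDesc (q ≫ v₀) (q ≫ v₁) :=
  rfl

theorem boundaryDesc_injective {v₀ v₁ w₀ w₁ : X ⟶ E}
    (h : boundaryDesc v₀ v₁ = boundaryDesc w₀ w₁) : v₀ = w₀ ∧ v₁ = w₁ := by
  constructor
  · ext n x
    exact (boundaryDesc_app_zero v₀ v₁ x).symm.trans
      ((ConcreteCategory.congr_hom (congr_app h n) _).trans (boundaryDesc_app_zero w₀ w₁ x))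
  · ext n x
    exact (boundaryDesc_app_one v₀ v₁ x).symm.trans
      ((ConcreteCategory.congr_hom (congr_app h n) _).trans (boundaryDesc_app_one w₀ w₁ x))

/-- A lift given on a subcomplex at all times and everywhere at times `0` and `1` extends,
provided that the corresponding inclusion has the left lifting property. -/
theorem exists_extension_of_ends {S : X.Subcomplex} {p : E ⟶ Z}
    [HasLiftingProperty (S.unionProd (∂Δ[1] : (Δ[1] : SSet.{u}).Subcomplex)).ι p]
    (u : (S : SSet) ⊗ Δ[1] ⟶ E) (v₀ v₁ : X ⟶ E) (b : X ⊗ Δ[1] ⟶ Z)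
    (huv₀ : ι₀ ≫ u = S.ι ≫ v₀) (huv₁ : ι₁ ≫ u = S.ι ≫ v₁) (hu : u ≫ p = S.ι ▷ _ ≫ b)
    (hv₀ : v₀ ≫ p = ι₀ ≫ b) (hv₁ : v₁ ≫ p = ι₁ ≫ b) :
    ∃ l : X ⊗ Δ[1] ⟶ E, S.ι ▷ _ ≫ l = u ∧ ι₀ ≫ l = v₀ ∧ ι₁ ≫ l = v₁ ∧ l ≫ p = b := by
  let sq := Subcomplex.unionProd.isPushout S (∂Δ[1] : (Δ[1] : SSet.{u}).Subcomplex)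
  let k := sq.desc (boundaryDesc v₀ v₁) u (by
    rw [whiskerLeft_boundary_ι_comp, whiskerRight_comp_boundaryDesc, huv₀, huv₁])
  have hk₁ : Subcomplex.unionProd.ι₁ _ _ ≫ k = boundaryDesc v₀ v₁ := sq.inl_desc _ _ _
  have hk₂ : Subcomplex.unionProd.ι₂ _ _ ≫ k = u := sq.inr_desc _ _ _
  have comm : CommSq k (S.unionProd (∂Δ[1] : (Δ[1] : SSet.{u}).Subcomplex)).ι p b := ⟨by
    apply sq.hom_ext
    · rw [reassoc_of% hk₁, boundaryDesc_comp, Subcomplex.unionProd.ι₁_ι_assoc,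
        whiskerLeft_boundary_ι_comp, hv₀, hv₁]
    · rw [reassoc_of% hk₂, hu, Subcomplex.unionProd.ι₂_ι_assoc]⟩
  have h := boundaryDesc_injective (v₀ := ι₀ ≫ comm.lift) (v₁ := ι₁ ≫ comm.lift)
    (w₀ := v₀) (w₁ := v₁) (by
      rw [← whiskerLeft_boundary_ι_comp, ← Subcomplex.unionProd.ι₁_ι_assoc, comm.fac_left, hk₁])
  refine ⟨comm.lift, ?_, h.1, h.2, comm.fac_right⟩
  rw [← Subcomplex.unionProd.ι₂_ι_assoc, comm.fac_left, hk₂]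
end

/-! ### Homotopy equivalences and trivial fibrations -/

section
open MonoidalCategory CartesianMonoidalCategory HomotopicalAlgebra SSet SSet.modelCategoryQuillen
  Limits MonoidalClosed

variable {X Y Z W E : SSet.{u}}

/-- Homotopies between maps of simplicial sets, from the underlying map out of the cylinder. -/
noncomputable def homotopyMk {f g : X ⟶ Y} (h : X ⊗ Δ[1] ⟶ Y) (h₀ : ι₀ ≫ h = f)
    (h₁ : ι₁ ≫ h = g) : SSet.Homotopy f g where
  h := h
  h₀ := h₀
  h₁ := h₁
  rel := by
    ext n ⟨⟨x, hx⟩, _⟩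
    exact hx.elim

/-- The relation of being homotopic, by a single homotopy. -/
def Homotopic (f g : X ⟶ Y) : Prop := Nonempty (SSet.Homotopy f g)

theorem Homotopic.refl (f : X ⟶ Y) : Homotopic f f :=
  ⟨homotopyMk (fst _ _ ≫ f) rfl rfl⟩

theorem Homotopic.postcomp {f g : X ⟶ Y} (h : Homotopic f g) (k : Y ⟶ Z) :
    Homotopic (f ≫ k) (g ≫ k) := by
  obtain ⟨h⟩ := h
  exact ⟨homotopyMk (h.h ≫ k) (by rw [h.h₀_assoc]) (by rw [h.h₁_assoc])⟩

theorem Homotopic.precomp {f g : X ⟶ Y} (h : Homotopic f g) (k : Z ⟶ X) :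
    Homotopic (k ≫ f) (k ≫ g) := by
  obtain ⟨h⟩ := h
  exact ⟨homotopyMk (k ▷ _ ≫ h.h) (by rw [ι₀_comp_assoc, h.h₀]) (by rw [ι₁_comp_assoc, h.h₁])⟩

/-- Two homotopies with a common source, with values in a Kan complex, give a homotopy between
their targets, by filling the horn that they form. -/
theorem Homotopic.of_common_source [KanComplex Y] {f g h : X ⟶ Y} (hg : Homotopic f g)
    (hh : Homotopic f h) : Homotopic g h := by
  obtain ⟨hg⟩ := hg
  obtain ⟨hh⟩ := hh
  obtain ⟨k, h₁, h₂, -⟩ := exists_homotopy_of_fibration (p := terminal.from Y) hg.h hh.h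
    (by rw [hg.h₀, hh.h₀]) (Subsingleton.elim _ _)
  exact ⟨homotopyMk k (by rw [h₁, hg.h₁]) (by rw [h₂, hh.h₁])⟩

theorem Homotopic.symm [KanComplex Y] {f g : X ⟶ Y} (h : Homotopic f g) : Homotopic g f :=
  h.of_common_source (.refl f)

theorem Homotopic.trans [KanComplex Y] {f g h : X ⟶ Y} (hfg : Homotopic f g)
    (hgh : Homotopic g h) : Homotopic f h :=
  hfg.symm.of_common_source hgh

/-- A map of simplicial sets which has an inverse up to homotopy. -/
def IsHomotopyEquiv (f : X ⟶ Y) : Prop :=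
  ∃ g : Y ⟶ X, Homotopic (f ≫ g) (𝟙 X) ∧ Homotopic (g ≫ f) (𝟙 Y)

theorem homotopyEquivalences_iff {X Y : Space.{u}} (f : X ⟶ Y) :
    homotopyEquivalences f ↔ IsHomotopyEquiv f.hom :=
  ⟨fun ⟨g, hg⟩ => ⟨g.hom, hg⟩, fun ⟨g, hg⟩ => ⟨ObjectProperty.homMk g, hg⟩⟩

theorem fibration_of_rlp {p : E ⟶ Z} (hp : I.rlp p) : Fibration p := by
  rw [← rlp_monomorphisms] at hp
  rw [fibration_iff]
  exact MorphismProperty.antitone_rlp J_le_monomorphisms _ hp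

theorem hasLiftingProperty_of_rlp {A B : SSet.{u}} (i : A ⟶ B) [Mono i] {p : E ⟶ Z}
    (hp : I.rlp p) : HasLiftingProperty i p := by
  rw [← rlp_monomorphisms] at hp
  exact hp _ (.infer_property _)

/-- Trivial fibrations have a section. -/
theorem exists_section_of_rlp {p : E ⟶ Z} (hp : I.rlp p) : ∃ s : Z ⟶ E, s ≫ p = 𝟙 Z := by
  have := hasLiftingProperty_of_rlp (⊥ : Z.Subcomplex).ι hp
  have comm : CommSq (Subcomplex.isInitialBot.to E) (⊥ : Z.Subcomplex).ι p (𝟙 Z) :=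
    ⟨Subcomplex.isInitialBot.hom_ext _ _⟩
  exact ⟨comm.lift, comm.fac_right⟩

/-- Any section of a trivial fibration is a homotopy inverse to it. -/
theorem homotopic_of_rlp {p : E ⟶ Z} (hp : I.rlp p) {s : Z ⟶ E} (hs : s ≫ p = 𝟙 Z) :
    Homotopic (p ≫ s) (𝟙 E) := by
  have := hasLiftingProperty_of_rlp
    ((⊥ : E.Subcomplex).unionProd (∂Δ[1] : (Δ[1] : SSet.{u}).Subcomplex)).ι hp
  obtain ⟨l, -, h₀, h₁, -⟩ := exists_extension_of_ends (S := (⊥ : E.Subcomplex)) (p := p)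
    (fst _ _ ≫ (⊥ : E.Subcomplex).ι) (p ≫ s) (𝟙 E) (fst _ _ ≫ p)
    (Subcomplex.isInitialBot.hom_ext _ _) (Subcomplex.isInitialBot.hom_ext _ _) rfl
    (by rw [Category.assoc, hs]; rfl) rfl
  exact ⟨homotopyMk l h₀ h₁⟩

theorem isHomotopyEquiv_of_rlp {p : E ⟶ Z} (hp : I.rlp p) : IsHomotopyEquiv p := by
  obtain ⟨s, hs⟩ := exists_section_of_rlp hp
  exact ⟨s, homotopic_of_rlp hp hs, by rw [hs]; exact .refl _⟩

/-- A fibration which deforms, fibre by fibre, onto a section is a trivial fibration. -/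
theorem rlp_of_deformation {p : E ⟶ Z} [Fibration p] {s : Z ⟶ E} (hs : s ≫ p = 𝟙 Z)
    (h : E ⊗ Δ[1] ⟶ E) (h₀ : ι₀ ≫ h = p ≫ s) (h₁ : ι₁ ≫ h = 𝟙 E) (hp : h ≫ p = fst _ _ ≫ p) :
    I.rlp p := by
  rintro _ _ _ ⟨n⟩
  refine ⟨fun {u v} sq => ⟨?_⟩⟩
  obtain ⟨l, hl₁, -, hl₃⟩ := exists_extension_of_start (p := p) (u ▷ _ ≫ h) (v ≫ s) (fst _ _ ≫ v)
    (by rw [ι₀_comp_assoc, h₀, reassoc_of% sq.w])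
    (by rw [Category.assoc, hp, whiskerRight_fst_assoc, whiskerRight_fst_assoc, sq.w])
    (by rw [Category.assoc, hs, ι₀_fst_assoc, Category.comp_id])
  exact ⟨⟨ι₁ ≫ l, by rw [← ι₁_comp_assoc, hl₁, ι₁_comp_assoc, h₁, Category.comp_id],
    by rw [Category.assoc, hl₃, ι₁_fst_assoc]⟩⟩

/-- A fibration between Kan complexes which is a homotopy equivalence is a trivial fibration. -/
theorem rlp_of_isHomotopyEquiv [KanComplex E] [KanComplex Z] {p : E ⟶ Z} [Fibration p]
    (h : IsHomotopyEquiv p) : I.rlp p := by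
  obtain ⟨g, hpg, ⟨hgp⟩⟩ := h
  -- The homotopy inverse is deformed to a strict section.
  obtain ⟨k, -, hk₀, hk⟩ := exists_extension_of_start (S := (⊥ : Z.Subcomplex)) (p := p)
    (fst _ _ ≫ (⊥ : Z.Subcomplex).ι ≫ g) g hgp.h rfl
    (by ext n ⟨⟨x, hx⟩, _⟩; exact hx.elim) hgp.h₀.symm
  have hs : (ι₁ ≫ k) ≫ p = 𝟙 Z := by rw [Category.assoc, hk, hgp.h₁]
  have hgs : Homotopic g (ι₁ ≫ k) := ⟨homotopyMk k hk₀ rfl⟩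
  generalize ι₁ ≫ k = s at hs hgs
  obtain ⟨e⟩ := ((hgs.precomp p).symm.trans hpg)
  -- `e` and `e ≫ p ≫ s` start at `p ≫ s` and have the same image under `p`.
  obtain ⟨h, h₀, h₁, hp⟩ := exists_homotopy_of_fibration (p := p) (e.h ≫ p ≫ s) e.h
    (by rw [e.h₀_assoc, e.h₀, Category.assoc, reassoc_of% hs])
    (by rw [Category.assoc, Category.assoc, hs, Category.comp_id])
  rw [e.h₁_assoc, Category.id_comp] at h₀
  rw [e.h₁] at h₁
  refine rlp_of_deformation hs h h₀ h₁ ?_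
  rw [hp, Category.assoc, Category.assoc, hs, e.h₁_assoc, Category.comp_id, Category.id_comp]

end

/-! ### Path spaces and mapping path spaces -/

section
open MonoidalCategory CartesianMonoidalCategory HomotopicalAlgebra SSet SSet.modelCategoryQuillen
  Limits MonoidalClosed

variable {X Y Z A B : SSet.{u}}

/-- The path space `Z ^ Δ[1]`. -/
noncomputable abbrev paths : SSet.{u} ⥤ SSet.{u} := ihom Δ[1]

/-- The homotopy adjoint to a map into a path space. -/
noncomputable def toHomotopy (k : A ⟶ paths.obj Z) : A ⊗ Δ[1] ⟶ Z :=
  (β_ _ _).hom ≫ uncurry k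

/-- The map into a path space adjoint to a homotopy. -/
noncomputable def ofHomotopy (h : A ⊗ Δ[1] ⟶ Z) : A ⟶ paths.obj Z :=
  curry ((β_ _ _).hom ≫ h)

@[simp]
theorem toHomotopy_ofHomotopy (h : A ⊗ Δ[1] ⟶ Z) : toHomotopy (ofHomotopy h) = h := by
  simp [toHomotopy, ofHomotopy]

@[simp]
theorem ofHomotopy_toHomotopy (k : A ⟶ paths.obj Z) : ofHomotopy (toHomotopy k) = k := by
  simp [toHomotopy, ofHomotopy]

theorem toHomotopy_comp (f : A ⟶ B) (k : B ⟶ paths.obj Z) :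
    toHomotopy (f ≫ k) = f ▷ _ ≫ toHomotopy k := by
  simp [toHomotopy, uncurry_natural_left]

theorem toHomotopy_comp_map (k : A ⟶ paths.obj Y) (f : Y ⟶ Z) :
    toHomotopy (k ≫ paths.map f) = toHomotopy k ≫ f := by
  simp [toHomotopy, uncurry_natural_right]

theorem toHomotopy_injective {k l : A ⟶ paths.obj Z} (h : toHomotopy k = toHomotopy l) : k = l := by
  rw [← ofHomotopy_toHomotopy k, h, ofHomotopy_toHomotopy]

/-- Evaluation of paths at their source. -/
noncomputable def ev₀ : paths ⟶ 𝟭 SSet.{u} where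
  app Z := ι₀ ≫ toHomotopy (𝟙 _)
  naturality Y Z f := by
    dsimp only [Functor.id_map]
    rw [Category.assoc, ← toHomotopy_comp_map, Category.id_comp, ← ι₀_comp_assoc,
      ← toHomotopy_comp, Category.comp_id]

/-- Evaluation of paths at their target. -/
noncomputable def ev₁ : paths ⟶ 𝟭 SSet.{u} where
  app Z := ι₁ ≫ toHomotopy (𝟙 _)
  naturality Y Z f := by
    dsimp only [Functor.id_map]
    rw [Category.assoc, ← toHomotopy_comp_map, Category.id_comp, ← ι₁_comp_assoc,
      ← toHomotopy_comp, Category.comp_id]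

/-- The constant paths. -/
noncomputable def constPath : 𝟭 SSet.{u} ⟶ paths where
  app Z := ofHomotopy (fst _ _)
  naturality Y Z f := by
    apply toHomotopy_injective
    rw [toHomotopy_comp, toHomotopy_comp_map]
    simp

theorem comp_ev₀ (k : A ⟶ paths.obj Z) : k ≫ ev₀.app Z = ι₀ ≫ toHomotopy k := by
  dsimp only [ev₀]
  rw [← ι₀_comp_assoc, ← toHomotopy_comp, Category.comp_id]

theorem comp_ev₁ (k : A ⟶ paths.obj Z) : k ≫ ev₁.app Z = ι₁ ≫ toHomotopy k := by
  dsimp only [ev₁]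
  rw [← ι₁_comp_assoc, ← toHomotopy_comp, Category.comp_id]

theorem constPath_ev₀ (Z : SSet.{u}) : constPath.app Z ≫ ev₀.app Z = 𝟙 Z := by
  rw [comp_ev₀]
  dsimp only [constPath]
  rw [toHomotopy_ofHomotopy]
  rfl

theorem constPath_ev₁ (Z : SSet.{u}) : constPath.app Z ≫ ev₁.app Z = 𝟙 Z := by
  rw [comp_ev₁]
  dsimp only [constPath]
  rw [toHomotopy_ofHomotopy]
  rfl

theorem rlp_ev₀ (Z : SSet.{u}) [KanComplex Z] : I.rlp (ev₀.app Z) := by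
  rintro _ _ _ ⟨n⟩
  refine ⟨fun {u v} sq => ⟨?_⟩⟩
  have hw := sq.w
  rw [comp_ev₀] at hw
  obtain ⟨l, hl, hv, -⟩ := exists_extension_of_start (p := terminal.from Z) (toHomotopy u) v
    (terminal.from _) hw (Subsingleton.elim _ _) (Subsingleton.elim _ _)
  exact ⟨⟨ofHomotopy l, toHomotopy_injective (by rw [toHomotopy_comp, toHomotopy_ofHomotopy, hl]),
    by rw [comp_ev₀, toHomotopy_ofHomotopy, hv]⟩⟩

variable {N : SSet.{u}} {f : X ⟶ Y} {τ : N ⟶ X} {q : N ⟶ paths.obj Y}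

/-- The mapping path space of `f : X ⟶ Y`, the space of points `x` of `X` with a path in `Y` from
`f x`, is trivially fibred over `X`. -/
theorem rlp_mappingPath [KanComplex Y] (sq : IsPullback τ q f (ev₀.app Y)) : I.rlp τ :=
  MorphismProperty.of_isPullback (P := I.rlp) sq.flip (rlp_ev₀ Y)

/-- Evaluation at the end of the path is a fibration from the mapping path space to `Y`. -/
theorem fibration_mappingPath [KanComplex X] [KanComplex Y] (sq : IsPullback τ q f (ev₀.app Y)) :
    Fibration (q ≫ ev₁.app Y : N ⟶ Y) := by
  have key (n : ℕ) (i : Fin (n + 2)) :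
      HasLiftingProperty Λ[n + 1, i].ι (q ≫ ev₁.app Y : N ⟶ Y) := by
    refine ⟨fun {u v} comm => ⟨?_⟩⟩
    -- The point `x` of `X` is extended first; then the path has prescribed ends `f x` and `v`.
    obtain ⟨x, hx⟩ := KanComplex.hornFilling (u ≫ τ)
    have : HasLiftingProperty
        (Λ[n + 1, i].unionProd (∂Δ[1] : (Δ[1] : SSet.{u}).Subcomplex)).ι (terminal.from Y) :=
      anodyneExtensions_unionProd_ι' _ _ (.horn_ι i) _
        ((HomotopicalAlgebra.fibration_iff _).1 inferInstance)
    obtain ⟨l, hl, hl₀, hl₁, -⟩ := exists_extension_of_ends (p := terminal.from Y)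
      (toHomotopy (u ≫ q)) (x ≫ f) v (terminal.from _)
      (by rw [← comp_ev₀, ← reassoc_of% hx, sq.w, Category.assoc])
      (by rw [← comp_ev₁, Category.assoc]; exact comm.w) (Subsingleton.elim _ _)
      (Subsingleton.elim _ _) (Subsingleton.elim _ _)
    refine ⟨⟨sq.lift x (ofHomotopy l) (by rw [comp_ev₀, toHomotopy_ofHomotopy, hl₀]),
      sq.hom_ext ?_ ?_, ?_⟩⟩
    · rw [Category.assoc, sq.lift_fst, hx]
    · rw [Category.assoc, sq.lift_snd]
      exact toHomotopy_injective (by rw [toHomotopy_comp, toHomotopy_ofHomotopy, hl])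
    · rw [sq.lift_snd_assoc]
      exact (comp_ev₁ _).trans (by rw [toHomotopy_ofHomotopy, hl₁])
  rw [fibration_iff]
  intro _ _ _ h
  simp only [J, MorphismProperty.iSup_iff] at h
  obtain ⟨n, ⟨i⟩⟩ := h
  exact key n i

theorem kanComplex_of_fibration (p : X ⟶ Y) [Fibration p] [KanComplex Y] : KanComplex X :=
  isFibrant_of_fibration p

/-- A map `π` is a homotopy equivalence if it becomes one after composition with a section of a
trivial fibration. -/
theorem isHomotopyEquiv_of_section {σ : X ⟶ N} {π : N ⟶ Y} [KanComplex N] [KanComplex Y]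
    (hτ : I.rlp τ) (hσ : σ ≫ τ = 𝟙 X) (hf : IsHomotopyEquiv (σ ≫ π)) : IsHomotopyEquiv π := by
  obtain ⟨g, h₁, h₂⟩ := hf
  have hτσ := homotopic_of_rlp hτ hσ
  refine ⟨g ≫ σ, ?_, by rwa [Category.assoc]⟩
  have h₃ : Homotopic (π ≫ g ≫ σ) (τ ≫ (σ ≫ π) ≫ g ≫ σ) := by
    simpa using! (hτσ.symm.postcomp (π ≫ g ≫ σ))
  have h₄ : Homotopic (τ ≫ (σ ≫ π) ≫ g ≫ σ) (τ ≫ σ) := by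
    simpa using! (h₁.postcomp σ).precomp τ
  exact h₃.trans (h₄.trans hτσ)
end

/-! ### Diagrams of spaces -/

section
open HomotopicalAlgebra SSet SSet.modelCategoryQuillen Limits

variable {C : Type} [Category.{0} C]

/-- The diagram of simplicial sets underlying a diagram of spaces. -/
abbrev underlying (A : Diagram.{u} C) : Cᵒᵖ ⥤ SSet.{u} := A ⋙ ObjectProperty.ι _

/-- The map of diagrams of simplicial sets underlying a map of diagrams of spaces. -/
abbrev underlyingMap {A B : Diagram.{u} C} (f : A ⟶ B) : underlying A ⟶ underlying B :=
  Functor.whiskerRight f (ObjectProperty.ι _)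

/-- Maps of diagrams of spaces which are trivial Kan fibrations at each object. -/
def levelwiseTrivialFibrations : MorphismProperty (Diagram.{u} C) := fun _ _ f =>
  ∀ c, I.rlp (f.app c).hom

theorem levelwiseTrivialFibrations_le :
    levelwiseTrivialFibrations (C := C) ≤ levelwiseEquivalences.{u} C := fun _ _ _ h c =>
  (homotopyEquivalences_iff _).2 (isHomotopyEquiv_of_rlp (h c))

theorem kanComplex_of_rlp {A : Diagram.{u} C} {G : Cᵒᵖ ⥤ SSet.{u}} {p : G ⟶ underlying A}
    (hp : ∀ c, I.rlp (p.app c)) (c : Cᵒᵖ) : SSet.KanComplex (G.obj c) := by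
  have := fibration_of_rlp (hp c)
  have : SSet.KanComplex ((underlying A).obj c) := (A.obj c).property
  exact kanComplex_of_fibration (p.app c)

/-- The map of diagrams of spaces with a given underlying map. -/
def diagramHomMk {A B : Diagram.{u} C} (f : underlying A ⟶ underlying B) : A ⟶ B where
  app c := ObjectProperty.homMk (f.app c)
  naturality c d g := by
    ext1
    exact f.naturality g

theorem isPullback_app {G₁ G₂ G₃ G₄ : Cᵒᵖ ⥤ SSet.{u}} {a : G₁ ⟶ G₂} {b : G₁ ⟶ G₃} {c : G₂ ⟶ G₄}
    {d : G₃ ⟶ G₄} (h : IsPullback a b c d) (X : Cᵒᵖ) :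
    IsPullback (a.app X) (b.app X) (c.app X) (d.app X) :=
  h.map ((evaluation _ _).obj X)

/-- Levelwise trivial fibrations can be pulled back along maps of diagrams of spaces. -/
theorem exists_square {A B B' : Diagram.{u} C} (F : A ⟶ B) (t : B' ⟶ B)
    (ht : levelwiseTrivialFibrations t) :
    ∃ (A' : Diagram.{u} C) (t' : A' ⟶ A) (F' : A' ⟶ B'),
      levelwiseTrivialFibrations t' ∧ t' ≫ F = F' ≫ t := by
  have sq := IsPullback.of_hasPullback (underlyingMap F) (underlyingMap t)
  have hp (c) : I.rlp ((pullback.fst (underlyingMap F) (underlyingMap t)).app c) :=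
    MorphismProperty.of_isPullback (P := I.rlp) (isPullback_app sq c).flip (ht c)
  refine ⟨ObjectProperty.lift _ _ (kanComplex_of_rlp hp), diagramHomMk (pullback.fst _ _),
    diagramHomMk (pullback.snd _ _), hp, ?_⟩
  ext c : 3
  exact congr_app sq.w c

/-- The functorial factorization through the mapping path space. -/
theorem exists_factorization {A B : Diagram.{u} C} (f : A ⟶ B) :
    ∃ (N : Diagram.{u} C) (τ : N ⟶ A) (σ : A ⟶ N) (π : N ⟶ B),
      levelwiseTrivialFibrations τ ∧ σ ≫ τ = 𝟙 A ∧ σ ≫ π = f ∧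
      ∀ c, Fibration (π.app c).hom := by
  have hA (c) : SSet.KanComplex ((underlying A).obj c) := (A.obj c).property
  have hB (c) : SSet.KanComplex ((underlying B).obj c) := (B.obj c).property
  have sq := IsPullback.of_hasPullback (underlyingMap f) (Functor.whiskerLeft (underlying B) ev₀)
  let cst : underlying B ⟶ underlying B ⋙ paths := Functor.whiskerLeft (underlying B) constPath
  let π' : pullback (underlyingMap f) (Functor.whiskerLeft (underlying B) ev₀) ⟶ underlying B :=
     pullback.snd _ _ ≫ Functor.whiskerLeft (underlying B) ev₁
  let σ' := sq.lift (𝟙 _) (underlyingMap f ≫ cst) (by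
    rw [Category.id_comp, Category.assoc]
    ext c : 2
    exact (congr_arg ((f.app c).hom ≫ ·) (constPath_ev₀ _)).symm)
  have hσ' : σ' ≫ pullback.fst _ _ = 𝟙 _ := sq.lift_fst _ _ _
  have hσ'π' : σ' ≫ π' = underlyingMap f := by
    dsimp only [σ', π']
    rw [sq.lift_snd_assoc]
    ext c : 2
    exact congr_arg ((f.app c).hom ≫ ·) (constPath_ev₁ _)
  have hπ' (c) : Fibration (π'.app c) := fibration_mappingPath (isPullback_app sq c)
  have hp (c) : I.rlp ((pullback.fst (underlyingMap f)
      (Functor.whiskerLeft (underlying B) ev₀)).app c) :=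
    rlp_mappingPath (isPullback_app sq c)
  refine ⟨ObjectProperty.lift _ _ (kanComplex_of_rlp hp), diagramHomMk (pullback.fst _ _),
    diagramHomMk σ', diagramHomMk π', hp, ?_, ?_, hπ'⟩
  · ext c : 3
    exact congr_app hσ' c
  · ext c : 3
    exact congr_app hσ'π' c
end

/-! ### Fractions in the homotopy category -/

section
open HomotopicalAlgebra SSet SSet.modelCategoryQuillen Limits

variable {C : Type} [Category.{0} C]

theorem isIso_toHo_map {A B : Diagram.{u} C} (t : A ⟶ B) (ht : levelwiseTrivialFibrations t) :
    IsIso ((toHo.{u} C).map t) :=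
  Localization.inverts _ (levelwiseEquivalences.{u} C) t (levelwiseTrivialFibrations_le _ ht)

/-- The maps in the homotopy category of the form `t⁻¹ ≫ F`, with `F` a strict map and `t` a
levelwise trivial fibration. -/
def fractions : MorphismProperty (HoPrSh.{u} C) := fun X Y φ =>
  ∃ (A B A' : Diagram.{u} C) (t : A' ⟶ A) (F : A' ⟶ B) (eX : (toHo.{u} C).obj A = X)
    (eY : (toHo.{u} C).obj B = Y), levelwiseTrivialFibrations t ∧
      (toHo.{u} C).map t ≫ eqToHom eX ≫ φ = (toHo.{u} C).map F ≫ eqToHom eY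

theorem levelwiseTrivialFibrations_id (A : Diagram.{u} C) : levelwiseTrivialFibrations (𝟙 A) :=
  fun _ => MorphismProperty.id_mem I.rlp _

theorem levelwiseTrivialFibrations_comp {A B D : Diagram.{u} C} {s : A ⟶ B} {t : B ⟶ D}
    (hs : levelwiseTrivialFibrations s) (ht : levelwiseTrivialFibrations t) :
    levelwiseTrivialFibrations (s ≫ t) :=
  fun c => MorphismProperty.comp_mem I.rlp _ _ (hs c) (ht c)

instance : (fractions.{u} (C := C)).IsStableUnderComposition where
  comp_mem {X Y Z} φ ψ hφ hψ := by
    obtain ⟨A, B, A', t, F, rfl, rfl, ht, h⟩ := hφ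
    obtain ⟨B₂, D, B', t', G, eB, rfl, ht', h'⟩ := hψ
    obtain rfl : B₂ = B := (Localization.Construction.objEquiv _).injective eB
    obtain ⟨A'', s, F', hs, hw⟩ := exists_square F t' ht'
    refine ⟨A, D, A'', s ≫ t, F' ≫ G, rfl, rfl, levelwiseTrivialFibrations_comp hs ht, ?_⟩
    simp only [eqToHom_refl, Category.id_comp, Category.comp_id, Functor.map_comp,
      Category.assoc] at h h' ⊢
    rw [reassoc_of% h, ← h', ← Functor.map_comp_assoc, hw, Functor.map_comp_assoc]

/-- Every map in the homotopy category is a fraction whose denominator is a levelwise trivial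
fibration. -/
theorem fractions_eq_top : fractions.{u} (C := C) = ⊤ := by
  refine Localization.Construction.morphismProperty_eq_top _ (fun A B f => ?_)
    (fun A B w hw => ?_)
  · exact ⟨A, B, A, 𝟙 A, f, rfl, rfl, levelwiseTrivialFibrations_id A, by simp⟩
  · obtain ⟨N, τ, σ, π, hτ, hστ, hσπ, hπ⟩ := exists_factorization w
    have hπ' : levelwiseTrivialFibrations π := fun c => by
      have := (N.obj c).property
      have := (B.obj c).property
      have := hπ c
      refine rlp_of_isHomotopyEquiv (isHomotopyEquiv_of_section (hτ c)
        (congr_arg (fun k => (k.app c).hom) hστ) ?_)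
      rw [show (σ.app c).hom ≫ (π.app c).hom = (w.app c).hom from
        congr_arg (fun k => (k.app c).hom) hσπ]
      exact (homotopyEquivalences_iff _).1 (hw c)
    refine ⟨B, A, N, π, τ, rfl, rfl, hπ', ?_⟩
    have := isIso_toHo_map τ hτ
    have hw' : (toHo.{u} C).map w ≫ Localization.Construction.wInv w hw = 𝟙 _ :=
      (Localization.Construction.wIso w hw).hom_inv_id
    have h₁ : (toHo.{u} C).map σ ≫ (toHo.{u} C).map τ = 𝟙 _ := by
      rw [← Functor.map_comp, hστ, CategoryTheory.Functor.map_id]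
    have h₂ : (toHo.{u} C).map τ ≫ (toHo.{u} C).map σ = 𝟙 _ := by
      rw [← cancel_mono ((toHo.{u} C).map τ), Category.assoc, h₁, Category.comp_id,
        Category.id_comp]
    -- `τ` and `σ` become mutually inverse, so that `π` becomes `τ ≫ w`.
    have h₃ : (toHo.{u} C).map π = (toHo.{u} C).map τ ≫ (toHo.{u} C).map w := by
      rw [← hσπ, Functor.map_comp, reassoc_of% h₂]
    simp only [eqToHom_refl, Category.id_comp, Category.comp_id]
    rw [h₃, Category.assoc]
    exact (congr_arg _ hw').trans (Category.comp_id _)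

/-- Every map in the homotopy category is presented by a strict map. -/
theorem exists_strict_presentation {X Y : HoPrSh.{u} C} (φ : X ⟶ Y) :
    ∃ (A B : Diagram.{u} C) (F : A ⟶ B), Nonempty (Arrow.mk φ ≅ Arrow.mk ((toHo.{u} C).map F)) := by
  have hφ : fractions φ := by rw [fractions_eq_top]; trivial
  obtain ⟨A, B, A', t, F, rfl, rfl, ht, h⟩ := hφ
  have := isIso_toHo_map t ht
  refine ⟨A', B, F, ⟨Arrow.isoMk (asIso ((toHo.{u} C).map t)).symm (Iso.refl _) ?_⟩⟩
  have h' : (toHo.{u} C).map t ≫ φ = (toHo.{u} C).map F := by simpa using h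
  simp [← h']
end

/-! ### Coproducts of simplicial sets -/

section
open MonoidalCategory CartesianMonoidalCategory HomotopicalAlgebra SSet SSet.modelCategoryQuillen
  Limits MonoidalClosed

variable {I J : Type} {X Y Z : I → SSet.{u}}

/-- The coproduct of a family of simplicial sets, as the simplicial set of pairs. -/
def coprodSSet (X : I → SSet.{u}) : SSet.{u} where
  obj n := Σ i, (X i).obj n
  map f := ↾fun x => ⟨x.1, (X x.1).map f x.2⟩

/-- The map of coproducts induced by a map of index types and a family of maps. -/
def coprodMap {X' : J → SSet.{u}} (r : I → J) (f : ∀ i, X i ⟶ X' (r i)) :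
    coprodSSet X ⟶ coprodSSet X' where
  app n := ↾fun x => ⟨r x.1, (f x.1).app n x.2⟩
  naturality n m g := by
    ext x
    exact congr_arg (Sigma.mk (r x.1)) (ConcreteCategory.congr_hom ((f x.1).naturality g) x.2)

/-- The inclusion of a summand. -/
def coprodIncl (X : I → SSet.{u}) (i : I) : X i ⟶ coprodSSet X where
  app n := ↾fun x => ⟨i, x⟩

/-- A coproduct of homotopy equivalences is one: the chosen inverses and homotopies are assembled
summand by summand. -/
theorem isHomotopyEquiv_coprodMap {f : ∀ i, X i ⟶ Y i} (hf : ∀ i, IsHomotopyEquiv (f i)) :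
    IsHomotopyEquiv (coprodMap id f) := by
  have key {Z : I → SSet.{u}} {a b : ∀ i, Z i ⟶ Z i} (h : ∀ i, Homotopic (a i) (b i)) :
      Homotopic (coprodMap id a) (coprodMap id b) := by
    let H (i) := (h i).some
    refine ⟨homotopyMk
      { app n := ↾fun x => ⟨x.1.1, (H x.1.1).h.app n ((x.1.2, x.2) : (Z x.1.1 ⊗ Δ[1]).obj n)⟩
        naturality n m g := by
          ext ⟨⟨i, z⟩, t⟩
          let zt : (Z i ⊗ Δ[1]).obj n := (z, t)
          exact congr_arg (Sigma.mk i) (ConcreteCategory.congr_hom ((H i).h.naturality g) zt) }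
        ?_ ?_⟩
    · ext n x
      exact congr_arg (Sigma.mk x.1) (ConcreteCategory.congr_hom (congr_app (H x.1).h₀ n) x.2)
    · ext n x
      exact congr_arg (Sigma.mk x.1) (ConcreteCategory.congr_hom (congr_app (H x.1).h₁ n) x.2)
  choose g h₁ h₂ using hf
  exact ⟨coprodMap id g, key h₁, key h₂⟩

theorem index_map {A : SSet.{u}} (k : A ⟶ coprodSSet X) {m m' : SimplexCategoryᵒᵖ} (f : m ⟶ m')
    (x : A.obj m) : (k.app m' (A.map f x)).1 = (k.app m x).1 :=
  congr_arg Sigma.fst (ConcreteCategory.congr_hom (k.naturality f) x)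

theorem const_mem_horn {n : ℕ} {i j a : Fin (n + 2)} (hj : j ≠ i) (ha : j ≠ a)
    (m : SimplexCategoryᵒᵖ) :
    stdSimplex.const (n + 1) a m ∈ (Λ[n + 1, i] : (Δ[n + 1] : SSet.{u}).Subcomplex).obj m := by
  obtain ⟨m⟩ := m
  induction m using SimplexCategory.rec with | _ m
  rw [mem_horn_iff_notMem_range]
  refine ⟨j, hj, ?_⟩
  rintro ⟨p, hp⟩
  exact ha hp.symm

theorem edge_mem_horn {n : ℕ} {i j a b : Fin (n + 2)} (hab : a ≤ b) (hj : j ≠ i) (ha : j ≠ a)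
    (hb : j ≠ b) : stdSimplex.edge (n + 1) a b hab ∈
      (Λ[n + 1, i] : (Δ[n + 1] : SSet.{u}).Subcomplex).obj (Opposite.op ⦋1⦌) := by
  rw [mem_horn_iff_notMem_range]
  refine ⟨j, hj, ?_⟩
  rintro ⟨p, hp⟩
  obtain rfl | rfl : p = 0 ∨ p = 1 := by lia
  · exact ha hp.symm
  · exact hb hp.symm

/-- Two vertices of a horn which are joined by an edge of the horn are mapped to the same summand
of a coproduct. -/
theorem index_edge_eq {n : ℕ} {i j a b : Fin (n + 2)}
    (k : (Λ[n + 1, i] : SSet.{u}) ⟶ coprodSSet X) (hab : a ≤ b) (hj : j ≠ i) (ha : j ≠ a)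
    (hb : j ≠ b) : (k.app (Opposite.op ⦋0⦌) ⟨_, const_mem_horn hj ha _⟩).1 =
      (k.app (Opposite.op ⦋0⦌) ⟨_, const_mem_horn hj hb _⟩).1 := by
  have h (p : Fin 2) (c) (hc : j ≠ c) (hpc : ![a, b] p = c) :
      (k.app (Opposite.op ⦋0⦌) ⟨_, const_mem_horn hj hc _⟩).1 =
      (k.app (Opposite.op ⦋1⦌) ⟨_, edge_mem_horn hab hj ha hb⟩).1 := by
    refine Eq.trans ?_ (index_map k (SimplexCategory.const ⦋0⦌ ⦋1⦌ p).op ⟨_, _⟩)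
    subst hpc
    rfl
  rw [h 0 a ha rfl, h 1 b hb rfl]

/-- All the simplices of a horn are mapped to the same summand of a coproduct. -/
theorem index_horn_eq {n : ℕ} {i : Fin (n + 2)} (k : (Λ[n + 1, i] : SSet.{u}) ⟶ coprodSSet X)
    {m : SimplexCategoryᵒᵖ} (x : (Λ[n + 1, i] : SSet.{u}).obj m) {j : Fin (n + 2)} (hj : j ≠ i) :
    (k.app m x).1 = (k.app (Opposite.op ⦋0⦌) ⟨_, const_mem_horn hj hj _⟩).1 := by
  obtain ⟨m⟩ := m
  induction m using SimplexCategory.rec with | _ m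
  obtain ⟨x, hx⟩ := x
  have hx' := hx
  rw [mem_horn_iff_notMem_range] at hx'
  obtain ⟨j', hj', hjx⟩ := hx'
  have h0 : j' ≠ x 0 := fun h => hjx ⟨0, h.symm⟩
  have h₁ : (k.app (Opposite.op ⦋0⦌) ⟨_, const_mem_horn hj' h0 _⟩).1 = (k.app _ ⟨x, hx⟩).1 :=
    index_map k (SimplexCategory.const ⦋0⦌ ⦋m⦌ 0).op ⟨x, hx⟩
  rw [← h₁]
  -- As the simplex misses `j'`, its first vertex is joined to `i` by an edge of the horn.
  obtain h | h := le_total (x 0) i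
  · exact index_edge_eq k h hj' h0 hj'
  · exact (index_edge_eq k h hj' hj' h0).symm

theorem exists_factor_of_index {A : SSet.{u}} (k : A ⟶ coprodSSet X) (j : I)
    (h : ∀ n (x : A.obj n), (k.app n x).1 = j) : ∃ l : A ⟶ X j, k = l ≫ coprodIncl X j := by
  have h' (n) (x : A.obj n) : ∃ y, k.app n x = ⟨j, y⟩ := ⟨h n x ▸ (k.app n x).2, by
    obtain rfl := h n x
    rfl⟩
  choose y hy using h'
  refine ⟨{ app n := ↾(y n), naturality n m f := ?_ }, ?_⟩
  · ext x
    have := ConcreteCategory.congr_hom (k.naturality f) x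
    exact eq_of_heq (Sigma.mk.inj ((hy _ _).symm.trans
      (this.trans (congr_arg ((coprodSSet X).map f) (hy n x))))).2
  · ext n x
    exact hy n x

theorem exists_factor_horn {n : ℕ} {i : Fin (n + 2)}
    (k : (Λ[n + 1, i] : SSet.{u}) ⟶ coprodSSet X) :
    ∃ (j : I) (l : (Λ[n + 1, i] : SSet.{u}) ⟶ X j), k = l ≫ coprodIncl X j := by
  obtain ⟨j, hj⟩ := exists_ne i
  exact ⟨_, exists_factor_of_index k _ fun _ x => index_horn_eq k x hj⟩

theorem exists_factor_simplex {n : SimplexCategory}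
    (k : (stdSimplex.{u}.obj n) ⟶ coprodSSet X) :
    ∃ (j : I) (l : (stdSimplex.{u}.obj n) ⟶ X j), k = l ≫ coprodIncl X j := by
  obtain ⟨⟨j, x⟩, rfl⟩ := SSet.yonedaEquiv.symm.surjective k
  exact ⟨j, yonedaEquiv.symm x, SSet.yonedaEquiv.injective ((Equiv.apply_symm_apply _ _).trans
    (congr_arg (Sigma.mk j) (Equiv.apply_symm_apply yonedaEquiv x).symm))⟩

theorem coprodIncl_injective {A : SSet.{u}} {j j' : I} {l : A ⟶ X j} {l' : A ⟶ X j'}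
    {n : SimplexCategoryᵒᵖ} (a : A.obj n)
    (h : l ≫ coprodIncl X j = l' ≫ coprodIncl X j') :
    ∃ e : j = j', l ≫ eqToHom (by rw [e]) = l' := by
  obtain rfl : j = j' := congr_arg Sigma.fst (ConcreteCategory.congr_hom (congr_app h n) a)
  refine ⟨rfl, ?_⟩
  ext m x
  simpa using! eq_of_heq (Sigma.mk.inj (ConcreteCategory.congr_hom (congr_app h m) x)).2

theorem kanComplex_coprod (hX : ∀ i, SSet.KanComplex (X i)) : SSet.KanComplex (coprodSSet X) := by
  have key (n : ℕ) (i : Fin (n + 2)) :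
      HasLiftingProperty Λ[n + 1, i].ι (terminal.from (coprodSSet X)) := by
    refine ⟨fun {u v} _ => ?_⟩
    obtain ⟨j, l, rfl⟩ := exists_factor_horn u
    obtain ⟨w, rfl⟩ := KanComplex.hornFilling l
    exact ⟨⟨w ≫ coprodIncl X j, rfl, Subsingleton.elim _ _⟩⟩
  rw [SSet.KanComplex, isFibrant_iff, fibration_iff]
  intro _ _ _ h
  simp only [modelCategoryQuillen.J, MorphismProperty.iSup_iff] at h
  obtain ⟨n, ⟨i⟩⟩ := h
  exact key n i

theorem fibration_coprodMap {X' : J → SSet.{u}} (r : I → J) (f : ∀ i, X i ⟶ X' (r i))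
    (hf : ∀ i, Fibration (f i)) : Fibration (coprodMap r f) := by
  have key (n : ℕ) (i : Fin (n + 2)) :
      HasLiftingProperty Λ[n + 1, i].ι (coprodMap r f) := by
    refine ⟨fun {u v} sq => ?_⟩
    obtain ⟨a, l, rfl⟩ := exists_factor_horn u
    obtain ⟨b, w, rfl⟩ := exists_factor_simplex v
    obtain ⟨p, hp⟩ := exists_ne i
    obtain ⟨rfl, h⟩ := coprodIncl_injective (l := l ≫ f a) (l' := Λ[n + 1, i].ι ≫ w)
      (n := Opposite.op ⦋0⦌) ⟨_, const_mem_horn hp hp _⟩ sq.w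
    have comm : CommSq l Λ[n + 1, i].ι (f a) w := ⟨by simpa using h⟩
    exact ⟨⟨comm.lift ≫ coprodIncl X a, by rw [comm.fac_left_assoc],
      congr_arg (· ≫ coprodIncl X' (r a)) comm.fac_right⟩⟩
  rw [fibration_iff]
  intro _ _ _ h
  simp only [modelCategoryQuillen.J, MorphismProperty.iSup_iff] at h
  obtain ⟨n, ⟨i⟩⟩ := h
  exact key n i

/-- Reindexing coproducts along a map of index types is cartesian with respect to maps of
coproducts that preserve the indices. -/
theorem isPullback_coprodMap {K : Type} {A B : J → SSet.{u}} (r : K → J) (f : ∀ j, A j ⟶ B j) :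
    IsPullback (coprodMap (X := fun i => A (r i)) r fun i => 𝟙 (A (r i)))
      (coprodMap (X := fun i => A (r i)) id fun i => f (r i))
      (coprodMap id f) (coprodMap (X := fun i => B (r i)) r fun i => 𝟙 (B (r i))) where
  w := rfl
  isLimit' := ⟨evaluationJointlyReflectsLimits _ fun n => by
    refine (isLimitMapConePullbackConeEquiv _ _).2 (IsPullback.isLimit ?_)
    refine (Types.isPullback_iff _ _ _ _).2 ⟨rfl, ?_, ?_⟩
    · rintro ⟨k, x⟩ ⟨k', x'⟩ ⟨h₁, h₂⟩
      obtain rfl : k = k' := congr_arg Sigma.fst h₂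
      exact congr_arg (Sigma.mk k) (eq_of_heq (Sigma.mk.inj h₁).2)
    · rintro ⟨j, a⟩ ⟨k, b⟩ h
      obtain rfl : j = r k := congr_arg Sigma.fst h
      exact ⟨⟨k, a⟩, rfl, congr_arg (Sigma.mk k) (eq_of_heq (Sigma.mk.inj h).2)⟩⟩
end

/-! ### The left Kan extension of strict diagrams -/

section
open Opposite

theorem inert_apply {m n : SimplexCategory} {f : m ⟶ n} (hf : inert f) (i : Fin (m.len + 1)) :
    (f.toOrderHom i : ℕ) = f.toOrderHom 0 + i := by
  induction i using Fin.induction with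
  | zero => simp
  | succ i ih => rw [hf i, ih]; simp; ring

theorem isActive_id (n : SimplexCategory) : IsActive (𝟙 n) := ⟨rfl, rfl⟩

theorem isActive_comp {k m n : SimplexCategory} {f : k ⟶ m} {g : m ⟶ n} (hf : IsActive f)
    (hg : IsActive g) : IsActive (f ≫ g) :=
  ⟨(congr_arg _ hf.1).trans hg.1, (congr_arg _ hf.2).trans hg.2⟩

/-- Every map of `Δ` is an active map followed by an inert map, the inclusion of the interval
that its image spans. -/
theorem exists_active_inert {n m : SimplexCategory} (θ : n ⟶ m) :
    ∃ (k : SimplexCategory) (α : n ⟶ k) (ι : k ⟶ m), IsActive α ∧ inert ι ∧ α ≫ ι = θ := by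
  have h0 (i : Fin (n.len + 1)) : θ.toOrderHom 0 ≤ θ.toOrderHom i :=
    θ.toOrderHom.monotone (Fin.zero_le _)
  have h1 (i : Fin (n.len + 1)) : θ.toOrderHom i ≤ θ.toOrderHom (Fin.last _) :=
    θ.toOrderHom.monotone (Fin.le_last _)
  refine ⟨⦋(θ.toOrderHom (Fin.last _) : ℕ) - θ.toOrderHom 0⦌,
    SimplexCategory.Hom.mk ⟨fun i => ⟨θ.toOrderHom i - θ.toOrderHom 0, ?_⟩, ?_⟩,
    SimplexCategory.Hom.mk ⟨fun i => ⟨θ.toOrderHom 0 + i, ?_⟩, ?_⟩, ⟨?_, ?_⟩, ?_, ?_⟩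
  · have := h0 i; have := h1 i
    lia
  · intro a b hab
    have := θ.toOrderHom.monotone hab
    simp only [Fin.mk_le_mk]
    lia
  · have := (θ.toOrderHom (Fin.last _)).isLt
    have := h0 (Fin.last _)
    have := i.isLt
    simp only [SimplexCategory.len_mk] at this
    lia
  · intro a b hab
    simp only [Fin.mk_le_mk]
    lia
  · exact Fin.ext (Nat.sub_self _)
  · exact Fin.ext rfl
  · exact fun i => (Nat.add_assoc _ _ _).symm
  · ext i : 3
    exact Fin.ext (Nat.add_sub_cancel' (h0 i))

/-- The factorization as an active map followed by an inert map is unique, since the image of an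
inert map is the interval between the images of the end-points. -/
theorem active_inert_unique {n m k₁ k₂ : SimplexCategory} {α₁ : n ⟶ k₁} {ι₁ : k₁ ⟶ m}
    {α₂ : n ⟶ k₂} {ι₂ : k₂ ⟶ m} (hα₁ : IsActive α₁) (hι₁ : inert ι₁) (hα₂ : IsActive α₂)
    (hι₂ : inert ι₂) (h : α₁ ≫ ι₁ = α₂ ≫ ι₂) :
    ∃ e : k₁ = k₂, α₁ ≫ eqToHom e = α₂ ∧ ι₁ = eqToHom e ≫ ι₂ := by
  have hv (i) : (ι₁.toOrderHom 0 : ℕ) + α₁.toOrderHom i = ι₂.toOrderHom 0 + α₂.toOrderHom i := by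
    rw [← inert_apply hι₁, ← inert_apply hι₂]
    exact congr_arg (fun f => (f.toOrderHom i : ℕ)) h
  have hz := hv 0
  have hl := hv (Fin.last _)
  rw [hα₁.1, hα₂.1] at hz
  rw [hα₁.2, hα₂.2] at hl
  simp only [Fin.val_zero, Fin.val_last, Nat.add_zero] at hz hl
  obtain rfl : k₁ = k₂ := SimplexCategory.ext (by lia)
  refine ⟨rfl, ?_, ?_⟩
  · ext i : 3
    have := hv i
    apply Fin.ext
    simp
    lia
  · ext i : 3
    apply Fin.ext
    simp
    rw [inert_apply hι₁, inert_apply hι₂, hz]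

/-- The active maps out of `n`. -/
abbrev ActiveMap (n : SimplexCategory) : Type :=
  Σ m : SimplexInert, {α : n ⟶ j.obj m // IsActive α}

theorem exists_restrict {n' n : SimplexCategory} (θ : n' ⟶ n) (i : ActiveMap n) :
    ∃ (i' : ActiveMap n') (ι : i'.1 ⟶ i.1), i'.2.1 ≫ j.map ι = θ ≫ i.2.1 := by
  obtain ⟨k, α, ι, hα, hι, h⟩ := exists_active_inert (θ ≫ i.2.1)
  exact ⟨⟨⟨k⟩, α, hα⟩, ⟨ι, hι⟩, h⟩

/-- The active part of the composite of a map of `Δ` and an active map. -/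
noncomputable def restrict {n' n : SimplexCategory} (θ : n' ⟶ n) (i : ActiveMap n) : ActiveMap n' :=
  (exists_restrict θ i).choose

/-- The inert part of the composite of a map of `Δ` and an active map. -/
noncomputable def restrictInert {n' n : SimplexCategory} (θ : n' ⟶ n) (i : ActiveMap n) :
    (restrict θ i).1 ⟶ i.1 :=
  (exists_restrict θ i).choose_spec.choose

theorem restrict_fac {n' n : SimplexCategory} (θ : n' ⟶ n) (i : ActiveMap n) :
    (restrict θ i).2.1 ≫ j.map (restrictInert θ i) = θ ≫ i.2.1 :=
  (exists_restrict θ i).choose_spec.choose_spec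

theorem restrict_restrict_fac {n'' n' n : SimplexCategory} (θ' : n'' ⟶ n') (θ : n' ⟶ n)
    (i : ActiveMap n) : (restrict θ' (restrict θ i)).2.1 ≫
      j.map (restrictInert θ' (restrict θ i) ≫ restrictInert θ i) = (θ' ≫ θ) ≫ i.2.1 := by
  rw [Functor.map_comp, ← Category.assoc, restrict_fac, Category.assoc, restrict_fac,
    Category.assoc]

/-- The value at `n` of the left Kan extension: the coproduct, over the active maps `n ⟶ m`,
of the values at `m`. -/
abbrev jShriekObj (A : Diagram.{u} SimplexInert) (n : SimplexCategory) : SSet.{u} :=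
  coprodSSet fun i : ActiveMap n => (A.obj (op i.1)).obj

/-- A simplex of the left Kan extension given by a section over `m` and a map `n ⟶ m` does not
depend on the factorization of this map as an active map followed by an inert map. -/
theorem jShriekObj_ext (A : Diagram.{u} SimplexInert) {n : SimplexCategory} {m : SimplexInert}
    {i₁ i₂ : ActiveMap n} (ι₁ : i₁.1 ⟶ m) (ι₂ : i₂.1 ⟶ m)
    (h : i₁.2.1 ≫ j.map ι₁ = i₂.2.1 ≫ j.map ι₂) {p : SimplexCategoryᵒᵖ}
    (a : (A.obj (op m)).obj.obj p) :
    (⟨i₁, (A.map ι₁.op).hom.app p a⟩ : (jShriekObj A n).obj p) =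
      ⟨i₂, (A.map ι₂.op).hom.app p a⟩ := by
  obtain ⟨⟨k₁⟩, α₁, hα₁⟩ := i₁
  obtain ⟨⟨k₂⟩, α₂, hα₂⟩ := i₂
  obtain ⟨rfl, h₁, h₂⟩ : ∃ e : k₁ = k₂, α₁ ≫ eqToHom e = α₂ ∧ ι₁.hom = eqToHom e ≫ ι₂.hom :=
    active_inert_unique hα₁ ι₁.2 hα₂ ι₂.2 h
  obtain rfl : α₁ = α₂ := (Category.comp_id α₁).symm.trans h₁
  obtain rfl : ι₁ = ι₂ := by
    ext1
    simpa using h₂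
  rfl

theorem jShriekObj_ext' (A : Diagram.{u} SimplexInert) {n : SimplexCategory}
    {i₁ i₂ : ActiveMap n} (ι : i₁.1 ⟶ i₂.1) (h : i₁.2.1 ≫ j.map ι = i₂.2.1)
    {p : SimplexCategoryᵒᵖ} (a : (A.obj (op i₂.1)).obj.obj p) :
    (⟨i₁, (A.map ι.op).hom.app p a⟩ : (jShriekObj A n).obj p) = ⟨i₂, a⟩ := by
  refine (jShriekObj_ext A ι (𝟙 _) (by simpa using h) a).trans ?_
  rw [op_id, A.map_id]
  rfl

/-- The restriction maps of the left Kan extension. -/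
noncomputable abbrev jShriekMap (A : Diagram.{u} SimplexInert) {n' n : SimplexCategory}
    (θ : n' ⟶ n) : jShriekObj A n ⟶ jShriekObj A n' :=
  coprodMap (restrict θ) fun i => (A.map (restrictInert θ i).op).hom

/-- The left Kan extension along `j` of a diagram of spaces. -/
noncomputable def jShriekDiagram (A : Diagram.{u} SimplexInert) : Diagram.{u} SimplexCategory where
  obj n := ⟨jShriekObj A n.unop, kanComplex_coprod fun i => (A.obj (op i.1)).property⟩
  map θ := ObjectProperty.homMk (jShriekMap A θ.unop)
  map_id n := by
    ext p ⟨i, a⟩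
    exact jShriekObj_ext' A _ ((restrict_fac _ i).trans (Category.id_comp _)) a
  map_comp {n n' n''} θ θ' := by
    ext p ⟨i, a⟩
    have h := jShriekObj_ext A (restrictInert (θ ≫ θ').unop i)
      (restrictInert θ'.unop (restrict θ.unop i) ≫ restrictInert θ.unop i)
      ((restrict_fac _ i).trans (restrict_restrict_fac θ'.unop θ.unop i).symm) a
    rw [op_comp, A.map_comp] at h
    exact h

/-- The left Kan extension along `j`, as a functor on strict diagrams. -/
noncomputable def jShriekStrict : Diagram.{u} SimplexInert ⥤ Diagram.{u} SimplexCategory where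
  obj := jShriekDiagram
  map {A B} f :=
    { app n := ObjectProperty.homMk (coprodMap id fun i => (f.app (op i.1)).hom)
      naturality n n' θ := by
        ext p ⟨i, a⟩
        refine congr_arg (Sigma.mk (restrict θ.unop i)) ?_
        exact ConcreteCategory.congr_hom (congr_app (congr_arg (·.hom)
          (f.naturality (restrictInert θ.unop i).op)) p) a }
  map_id A := rfl
  map_comp f g := rfl

/-- The left Kan extension along `j` is left adjoint to the restriction. -/
noncomputable def jShriekStrictAdj : jShriekStrict.{u} ⊣ restrictDiagram.{u}.functor :=
  Adjunction.mkOfUnitCounit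
    { unit :=
        { app A :=
            { app m := ObjectProperty.homMk
                (coprodIncl (fun i : ActiveMap (j.obj m.unop) => (A.obj (op i.1)).obj)
                  ⟨m.unop, 𝟙 _, isActive_id _⟩)
              naturality m m' f := by
                ext p a
                exact jShriekObj_ext A (i₁ := ⟨m'.unop, 𝟙 _, isActive_id _⟩) f.unop
                  (restrictInert (j.map f.unop) ⟨m.unop, 𝟙 _, isActive_id _⟩)
                  ((Category.id_comp _).trans ((restrict_fac (j.map f.unop)
                    ⟨m.unop, 𝟙 _, isActive_id _⟩).trans (Category.comp_id _)).symm)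
                  a }
          naturality A B f := rfl }
      counit :=
        { app X :=
            { app n := ObjectProperty.homMk
                { app p := ↾fun x => (X.map x.1.2.1.op).hom.app p x.2
                  naturality p p' g := by
                    ext ⟨i, x⟩
                    exact ConcreteCategory.congr_hom ((X.map i.2.1.op).hom.naturality g) x }
              naturality n n' θ := by
                ext p ⟨i, x⟩
                have h : X.map (j.map (restrictInert θ.unop i)).op ≫
                    X.map (restrict θ.unop i).2.1.op = X.map i.2.1.op ≫ X.map θ := by
                  rw [← X.map_comp, ← X.map_comp, ← op_comp, restrict_fac]
                  rfl
                exact ConcreteCategory.congr_hom (congr_app (congr_arg (·.hom) h) p) x }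
          naturality X Y f := by
            ext n p ⟨i, x⟩
            exact (ConcreteCategory.congr_hom (congr_app (congr_arg (·.hom)
              (f.naturality i.2.1.op)) p) x).symm }
      left_triangle := by
        ext A n p ⟨i, a⟩
        exact jShriekObj_ext' A (restrictInert i.2.1 ⟨i.1, 𝟙 _, isActive_id _⟩)
          ((restrict_fac _ _).trans (Category.comp_id _)) a
      right_triangle := by
        ext X m p x
        exact ConcreteCategory.congr_hom (congr_app (congr_arg (·.hom) (X.map_id _)) p) x }

end

/-! ### The left Kan extension on homotopy categories -/

section
open Opposite HomotopicalAlgebra SSet SSet.modelCategoryQuillen Limits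

/-- The left Kan extension of strict diagrams, which preserves levelwise homotopy
equivalences. -/
noncomputable def extendDiagram : LocalizerMorphism (levelwiseEquivalences.{u} SimplexInert)
    (levelwiseEquivalences.{u} SimplexCategory) where
  functor := jShriekStrict
  map _ _ f hf n := (homotopyEquivalences_iff _).2
    (isHomotopyEquiv_coprodMap (f := fun i : ActiveMap n.unop => (f.app (op i.1)).hom)
      fun i => (homotopyEquivalences_iff _).1 (hf (op i.1)))

/-- The left Kan extension functor on homotopy categories. -/
noncomputable def jShriekHo : HoPrSh.{u} SimplexInert ⥤ HoPrSh.{u} SimplexCategory :=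
  extendDiagram.{u}.localizedFunctor (toHo.{u} _) (toHo.{u} _)

noncomputable instance : CatCommSq jShriekStrict.{u} (toHo.{u} _) (toHo.{u} _) jShriekHo.{u} :=
  extendDiagram.{u}.catCommSq _ _

noncomputable instance : CatCommSq restrictDiagram.{u}.functor (toHo.{u} _) (toHo.{u} _)
    jStar.{u} :=
  restrictDiagram.{u}.catCommSq _ _

/-- The left Kan extension functor on homotopy categories is left adjoint to `jStar`. -/
noncomputable def jShriekHoAdj : jShriekHo.{u} ⊣ jStar.{u} :=
  jShriekStrictAdj.localization (toHo.{u} _) (levelwiseEquivalences.{u} _) (toHo.{u} _)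
    (levelwiseEquivalences.{u} _) jShriekHo jStar

/-- On an active map, the restriction map of the left Kan extension reindexes the summands. -/
theorem jShriekMap_active (A : Diagram.{u} SimplexInert) {k n : SimplexCategory} {α : k ⟶ n}
    (hα : IsActive α) :
    jShriekMap A α =
      coprodMap (X := fun i : ActiveMap n => (A.obj (op i.1)).obj)
        (X' := fun i : ActiveMap k => (A.obj (op i.1)).obj)
        (fun i => ⟨i.1, α ≫ i.2.1, isActive_comp hα i.2.2⟩)
        fun _ => 𝟙 _ := by
  ext p ⟨i, a⟩
  exact jShriekObj_ext' A (i₂ := ⟨i.1, α ≫ i.2.1, isActive_comp hα i.2.2⟩) (restrictInert α i)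
    (restrict_fac α i) a

/-- Left Kan extension sends every strict map to a CULF map. -/
theorem isCulfStrict_jShriekStrict {A B : Diagram.{u} SimplexInert} (f : A ⟶ B) :
    IsCulfStrict (jShriekStrict.map f) := by
  intro k n α hα
  let r (β : ActiveMap n) : ActiveMap k := ⟨β.1, α ≫ β.2.1, isActive_comp hα β.2.2⟩
  have hX (X : Diagram.{u} SimplexInert) : ((jShriekStrict.obj X).map α.op).hom =
      coprodMap (X := fun β : ActiveMap n => (X.obj (op β.1)).obj)
        (X' := fun γ : ActiveMap k => (X.obj (op γ.1)).obj) r fun β => 𝟙 _ :=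
    jShriekMap_active X hα
  have hid (X : Space.{u}) : homotopyEquivalences (𝟙 X) :=
    (homotopyEquivalences_iff _).2 ⟨𝟙 _, .refl _, .refl _⟩
  -- The restriction map of the target is already a fibration: it needs no replacement.
  refine ⟨(jShriekStrict.obj B).obj (op n), (jShriekStrict.obj A).obj (op n), 𝟙 _,
    (jShriekStrict.obj B).map α.op, (jShriekStrict.map f).app (op n),
    (jShriekStrict.obj A).map α.op, 𝟙 _, hid _, ?_, Category.id_comp _, ?_, hid _, rfl,
    Category.id_comp _⟩
  · rw [hX]
    exact fibration_coprodMap r _ fun _ => inferInstance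
  · rw [hX, hX]
    exact (isPullback_coprodMap r fun γ : ActiveMap k => (f.app (op γ.1)).hom).flip

end

end FreeDecomposition

theorem mainTheorem6 :
    FreeDecomposition.jStar.{u}.IsRightAdjoint ∧
    ∀ (jShriek : FreeDecomposition.HoPrSh.{u} FreeDecomposition.SimplexInert ⥤
          FreeDecomposition.HoPrSh.{u} SimplexCategory)
        (_ : jShriek ⊣ FreeDecomposition.jStar.{u})
        {A B : FreeDecomposition.HoPrSh.{u} FreeDecomposition.SimplexInert} (f : A ⟶ B),
      FreeDecomposition.IsCulf (jShriek.map f) := by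
  refine ⟨⟨_, ⟨FreeDecomposition.jShriekHoAdj⟩⟩, fun jShriek adj A B f => ?_⟩
  obtain ⟨A', B', F, ⟨e⟩⟩ := FreeDecomposition.exists_strict_presentation f
  let iso : jShriek ≅ FreeDecomposition.jShriekHo :=
    adj.leftAdjointUniq FreeDecomposition.jShriekHoAdj
  let iso' := CatCommSq.iso FreeDecomposition.jShriekStrict.{u}
    (FreeDecomposition.toHo.{u} _) (FreeDecomposition.toHo.{u} _) FreeDecomposition.jShriekHo
  exact ⟨_, _, FreeDecomposition.jShriekStrict.map F,
    ⟨jShriek.mapArrow.mapIso e ≪≫ ((Functor.mapArrowFunctor _ _).mapIso iso).app _ ≪≫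
      ((Functor.mapArrowFunctor _ _).mapIso iso').symm.app (Arrow.mk F)⟩,
    FreeDecomposition.isCulfStrict_jShriekStrict F⟩
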